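/- **Networks.** Let $\sigma(t)=\max\{t,0\}$ and, for $v\in\mathbb R^m$, let $\sigma_v(y)=\sigma(y-v)$ componentwise. A ReLU network with $L\ge 0$ hidden layers of widths $m_1,\dots,m_L\ge 1$ is a function $\mathbb R^d\to\mathbb R$ of the form $$x\mapsto W_L\,\sigma_{v_L}W_{L-1}\,\sigma_{v_{L-1}}\cdots W_1\,\sigma_{v_1}W_0\,x,$$ where $m_0=d$, $m_{L+1}=1$, $W_k\in\mathbb R^{m_{k+1}\times m_k}$ and $v_k\in\mathbb R^{m_k}$. For $G,N\in[0,\infty)$ and $S,B,F\in[0,\infty]$ let $\mathcal F_d(G,N,S,B,F)$ be the set of all functions $f$ of this form with depth $L\le G$, width $\max_{1\le k\le L} m_k\le N$, at most $S$ nonzero entries in all the $W_k$ and $v_k$ together, all entries of the $W_k$ and $v_k$ at most $B$ in absolute value, and $\sup_{x\in[0,1]^d}|f(x)|\le F$. **Theorem 2.4.** For every $\alpha\in(0,\infty)$ there are constants $A_1,A_2,A_3\in(0,\infty)$, depending only on $\alpha$, such that for all $a\in(0,1/2]$, $b\in(a,1]$ and $\varepsilon\in(0,1/2]$ there exists $$\tilde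 f\in\mathcal F_1\Big(A_1\log\tfrac1\varepsilon+139\log\tfrac1a,\;\;A_2\big(\tfrac1\varepsilon\big)^{1/\alpha}\log\tfrac1a,\;\;A_3\big(\tfrac1\varepsilon\big)^{1/\alpha}\log\tfrac1\varepsilon\,\log\tfrac1a+65440\big(\log\tfrac1a\big)^2,\;\;1,\;\;\infty\Big)$$ such that $$\sup_{z\in[a,b]}|\log z-\tilde f(z)|\le\varepsilon\qquad\text{and}\qquad \log a\le\tilde f(t)\le\log b\quad\text{for all }t\in\mathbb R.$$ -/

import Mathlib

open scoped ENNReal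

/-- The ReLU activation function `t ↦ max t 0`. -/
def relu (t : ℝ) : ℝ := max t 0

/-- The number of nonzero entries of a vector. -/
noncomputable def vecNNZ {m : ℕ} (v : Fin m → ℝ) : ℕ :=
  (Finset.univ.filter fun i => v i ≠ 0).card

/-- The number of nonzero entries of a matrix. -/
noncomputable def matNNZ {m n : ℕ} (W : Matrix (Fin m) (Fin n) ℝ) : ℕ :=
  (Finset.univ.filter fun ij : Fin m × Fin n => W ij.1 ij.2 ≠ 0).card

/-- The largest absolute value of an entry of a vector. -/
noncomputable def vecSup {m : ℕ} (v : Fin m → ℝ) : ℝ≥0∞ := ⨆ i, ‖v i‖ₑ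

/-- The largest absolute value of an entry of a matrix. -/
noncomputable def matSup {m n : ℕ} (W : Matrix (Fin m) (Fin n) ℝ) : ℝ≥0∞ :=
  ⨆ i, ⨆ j, ‖W i j‖ₑ

/-- `ReLUNet p d`: the parameters `W₀, v₁, W₁, …, v_L, W_L` of a fully connected ReLU network with
input dimension `d` and output dimension `p`, listed from the input to the output. The network is
either the last (linear) weight matrix alone, or a hidden layer with a positive number `m` of
neurons, given by its weight matrix and its shift (bias) vector, followed by a network with input
dimension `m`. -/
inductive ReLUNet (p : ℕ) : ℕ → Type
  | output {d : ℕ} (W : Matrix (Fin p) (Fin d) ℝ) : ReLUNet p d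
  | hidden {d m : ℕ} (hm : 0 < m) (W : Matrix (Fin m) (Fin d) ℝ) (v : Fin m → ℝ)
      (rest : ReLUNet p m) : ReLUNet p d

namespace ReLUNet

/-- The function `x ↦ W_L σ_{v_L} W_{L-1} ⋯ W₁ σ_{v₁} W₀ x`, where `σ_v y = relu (y - v)`
componentwise. -/
def eval {p : ℕ} : {d : ℕ} → ReLUNet p d → (Fin d → ℝ) → (Fin p → ℝ)
  | _, output W, x => W.mulVec x
  | _, hidden _ W v rest, x => rest.eval fun i => relu (W.mulVec x i - v i)

/-- The number `L` of hidden layers. -/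
def depth {p : ℕ} : {d : ℕ} → ReLUNet p d → ℕ
  | _, output _ => 0
  | _, hidden _ _ _ rest => rest.depth + 1

/-- The largest number of neurons in a hidden layer. -/
def width {p : ℕ} : {d : ℕ} → ReLUNet p d → ℕ
  | _, output _ => 0
  | _, hidden (m := m) _ _ _ rest => max m rest.width

/-- The number of nonzero parameters in all weight matrices and all bias vectors. -/
noncomputable def numNonzero {p : ℕ} : {d : ℕ} → ReLUNet p d → ℕ
  | _, output W => matNNZ W
  | _, hidden _ W v rest => matNNZ W + vecNNZ v + rest.numNonzero

/-- The largest absolute value of a parameter (weight or bias). -/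
noncomputable def paramSup {p : ℕ} : {d : ℕ} → ReLUNet p d → ℝ≥0∞
  | _, output W => matSup W
  | _, hidden _ W v rest => max (max (matSup W) (vecSup v)) rest.paramSup

end ReLUNet

/-- The space `F_d^FNN(G, N, S, B, F)` of functions `ℝ^d → ℝ` given by a ReLU network of depth at
most `G`, width at most `N`, with at most `S` nonzero parameters, all parameters bounded by `B` in
absolute value, and with supremum norm on `[0,1]^d` at most `F`. -/
def FNN (d : ℕ) (G N : ℝ) (S B F : ℝ≥0∞) : Set ((Fin d → ℝ) → ℝ) :=
  {f | ∃ net : ReLUNet 1 d,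
    (∀ x, f x = net.eval x 0) ∧
    (net.depth : ℝ) ≤ G ∧
    (net.width : ℝ) ≤ N ∧
    (net.numNonzero : ℝ≥0∞) ≤ S ∧
    net.paramSup ≤ B ∧
    (⨆ x ∈ Set.Icc (0 : Fin d → ℝ) 1, ‖f x‖ₑ) ≤ F}

/-!
The argument approximates the logarithm on one short interval `[q, 1]`, `q = 2 ^ (-1 / N)`, and
transports this approximation to all scales. If `g` agrees with `log` at both endpoints of `[q, 1]`,
then `log z` is approximated on `[q ^ M, 1]` by the sum over `l < M` of
`g (max q (min (z / q ^ l) 1))`. All terms but one are evaluated at an endpoint, where they are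
exact, so the errors do not accumulate (`abs_sum_clip_sub_log_le`). With `M = K N` and
`2 ^ (-K) ≤ a`, the number of pieces is of order `N log (1 / a)`.

The function `g y = ∑ i, cᵢ S^r (1 - lᵢ (1 - y))` is a combination of `2 ^ r`-th powers of affine
functions, where `S` is the interpolation of the square by `n` iterated tent maps, with error at
most `4⁻ⁿ` (`abs_sqApprox_sub_sq_le`). The coefficients reproduce the Taylor polynomial of the
logarithm of degree `2 ^ r ≥ α` (`exists_sum_pow_eq_taylor`), so `N` of order at most `ε ^ (-1 / α)`
and `n` of order `log (1 / ε)` suffice. Since `S 1 = 1`, the exactness at `1` only needs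
`∑ cᵢ = 0`, and the exactness at `q` is obtained by rescaling (`exists_rescale_exact`).
Only functions of one variable are composed, and no product of two different network outputs is needed.

All weights have to be at most one. The dyadic multiples `2 ^ k z` come from a chain of doublings
shared by all pieces (`Computes.double`). It has `O(log (1 / a))` layers and `O(log (1 / a) ^ 2)`
parameters, which accounts for the terms of the bounds without `ε`. The remaining division by
`q ^ j ≥ 1 / 2` is compensated by choosing `lᵢ ≤ 1 / 2` (`Computes.affine_clip`). The final
combination is divided by an integer `R` of order `log (1 / a)`, clamped, and recovered by adding
`R` copies (`Computes.clamp`). This step also confines the output to `[log a, log b]`.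
-/

/-! ### Squaring by iterated tent maps -/

/-- The iterated tent map `x ↦ T^n x` on `[0, 1]`, scaled by `4⁻ⁿ`. The scaling makes all
coefficients of the recursion at most one in absolute value. -/
noncomputable def scaledTent : ℕ → ℝ → ℝ
  | 0, x => x
  | n + 1, x => scaledTent n x / 2 - relu (scaledTent n x - (1 / 4) ^ n / 2)

/-- The piecewise linear interpolation of `x ↦ x ^ 2` on `[0, 1]` at the multiples of `2⁻ⁿ`. -/
noncomputable def sqApprox : ℕ → ℝ → ℝ
  | 0, x => x
  | n + 1, x => sqApprox n x - scaledTent (n + 1) x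

theorem relu_of_nonneg {t : ℝ} (h : 0 ≤ t) : relu t = t := max_eq_left h

theorem relu_of_nonpos {t : ℝ} (h : t ≤ 0) : relu t = 0 := max_eq_right h

theorem relu_nonneg (t : ℝ) : 0 ≤ relu t := le_max_right _ _

theorem scaledTent_mem {x : ℝ} (hx : x ∈ Set.Icc (0 : ℝ) 1) (n : ℕ) :
    scaledTent n x ∈ Set.Icc (0 : ℝ) ((1 / 4) ^ n) := by
  induction n with
  | zero => simpa [scaledTent] using hx
  | succ n ih =>
    obtain ⟨h0, h1⟩ := ih
    have h4 : (0 : ℝ) < (1 / 4) ^ n := by positivity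
    rw [scaledTent, pow_succ]
    rcases le_total (scaledTent n x - (1 / 4) ^ n / 2) 0 with h | h
    · rw [relu_of_nonpos h]
      constructor <;> linarith
    · rw [relu_of_nonneg h]
      constructor <;> linarith

/-- The tent map satisfies `4 (t - t²) = 2 T t - (T t)²`, so the error of the interpolation stays
of the form `4⁻ⁿ (t - t²)` with `t = T^n x`. -/
theorem sqApprox_sub_sq (n : ℕ) (x : ℝ) :
    sqApprox n x - x ^ 2 = scaledTent n x - 4 ^ n * scaledTent n x ^ 2 := by
  induction n with
  | zero => simp [scaledTent, sqApprox]
  | succ n ih =>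
    have h4 : (4 : ℝ) ^ n * (1 / 4) ^ n = 1 := by rw [← mul_pow]; norm_num
    have key : scaledTent n x - 4 ^ n * scaledTent n x ^ 2
        = 2 * scaledTent (n + 1) x - 4 ^ (n + 1) * scaledTent (n + 1) x ^ 2 := by
      rw [scaledTent, pow_succ]
      rcases le_total (scaledTent n x - (1 / 4) ^ n / 2) 0 with h | h
      · rw [relu_of_nonpos h]; ring
      · rw [relu_of_nonneg h]
        linear_combination ((1 / 4) ^ n - 2 * scaledTent n x) * h4
    rw [sqApprox]
    linarith

theorem sqApprox_mem {x : ℝ} (hx : x ∈ Set.Icc (0 : ℝ) 1) (n : ℕ) :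
    sqApprox n x ∈ Set.Icc (0 : ℝ) 1 := by
  constructor
  · have h := sqApprox_sub_sq n x
    obtain ⟨h0, h1⟩ := scaledTent_mem hx n
    have h4 : (4 : ℝ) ^ n * (1 / 4) ^ n = 1 := by rw [← mul_pow]; norm_num
    have : 4 ^ n * scaledTent n x ^ 2 ≤ scaledTent n x := by
      calc 4 ^ n * scaledTent n x ^ 2 = 4 ^ n * scaledTent n x * scaledTent n x := by ring
        _ ≤ 4 ^ n * (1 / 4) ^ n * scaledTent n x := by gcongr
        _ = scaledTent n x := by rw [h4, one_mul]
    nlinarith [sq_nonneg x]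
  · induction n with
    | zero => exact hx.2
    | succ n ih =>
      rw [sqApprox]
      linarith [(scaledTent_mem hx (n + 1)).1]

theorem abs_sqApprox_sub_sq_le {x : ℝ} (hx : x ∈ Set.Icc (0 : ℝ) 1) (n : ℕ) :
    |sqApprox n x - x ^ 2| ≤ (1 / 4) ^ n := by
  obtain ⟨h0, h1⟩ := scaledTent_mem hx n
  have h4 : (4 : ℝ) ^ n * (1 / 4) ^ n = 1 := by rw [← mul_pow]; norm_num
  have h5 : 4 ^ n * scaledTent n x ^ 2 ≤ scaledTent n x := by
    calc 4 ^ n * scaledTent n x ^ 2 = 4 ^ n * scaledTent n x * scaledTent n x := by ring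
      _ ≤ 4 ^ n * (1 / 4) ^ n * scaledTent n x := by gcongr
      _ = scaledTent n x := by rw [h4, one_mul]
  have h6 : 0 ≤ (4 : ℝ) ^ n * scaledTent n x ^ 2 := by positivity
  rw [sqApprox_sub_sq, abs_le]
  constructor <;> linarith

theorem sqApprox_one (n : ℕ) : sqApprox n 1 = 1 := by
  have h : ∀ n, scaledTent (n + 1) 1 = 0 := by
    intro n
    induction n with
    | zero => norm_num [scaledTent, relu]
    | succ n ih =>
      rw [scaledTent, ih, relu_of_nonpos]
      · norm_num
      · have : (0 : ℝ) < (1 / 4) ^ (n + 1) := by positivity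
        linarith
  induction n with
  | zero => rfl
  | succ n ih => rw [sqApprox, ih, h, sub_zero]

theorem sqApprox_iterate_mem {x : ℝ} (hx : x ∈ Set.Icc (0 : ℝ) 1) (n r : ℕ) :
    (sqApprox n)^[r] x ∈ Set.Icc (0 : ℝ) 1 := by
  induction r with
  | zero => exact hx
  | succ r ih => rw [Function.iterate_succ_apply']; exact sqApprox_mem ih n

theorem sqApprox_iterate_one (n r : ℕ) : (sqApprox n)^[r] 1 = 1 :=
  Function.iterate_fixed (sqApprox_one n) r

theorem abs_sqApprox_iterate_sub_pow_le {x : ℝ} (hx : x ∈ Set.Icc (0 : ℝ) 1) (n r : ℕ) :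
    |(sqApprox n)^[r] x - x ^ 2 ^ r| ≤ 2 ^ r * (1 / 4) ^ n := by
  have h4 : (0 : ℝ) < (1 / 4) ^ n := by positivity
  -- The squaring map is 2-Lipschitz on `[0, 1]`; the `- 1` absorbs the new error of each step.
  suffices h : |(sqApprox n)^[r] x - x ^ 2 ^ r| ≤ (2 ^ r - 1) * (1 / 4) ^ n by linarith
  induction r with
  | zero => simp
  | succ r ih =>
    rw [Function.iterate_succ_apply', pow_succ 2 r, pow_mul]
    have hs := sqApprox_iterate_mem hx n r
    have hx0 : 0 ≤ x ^ 2 ^ r := pow_nonneg hx.1 _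
    have hx1 : x ^ 2 ^ r ≤ 1 := pow_le_one₀ hx.1 hx.2
    set s := (sqApprox n)^[r] x
    set y := x ^ 2 ^ r
    have h1 := abs_sqApprox_sub_sq_le hs n
    have h2 : |s ^ 2 - y ^ 2| ≤ 2 * |s - y| := by
      rw [show s ^ 2 - y ^ 2 = (s + y) * (s - y) by ring, abs_mul,
        abs_of_nonneg (add_nonneg hs.1 hx0)]
      exact mul_le_mul_of_nonneg_right (by linarith [hs.2]) (abs_nonneg _)
    have h3 := abs_sub_le (sqApprox n s) (s ^ 2) (y ^ 2)
    rw [pow_succ (2 : ℝ) r]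
    linarith

/-! ### Reduction of the logarithm to one piece -/

/-- Summing a function `g` over the clipped rescalings `z / q^l` reproduces the logarithm: all terms
but one sit at an endpoint of `[q, 1]`, where `g` agrees with `log`. Errors of `g` inside `(q, 1)`
therefore do not accumulate. -/
theorem abs_sum_clip_sub_log_le {g : ℝ → ℝ} {q ε : ℝ} (hq0 : 0 < q) (hq1 : q ≤ 1) (hε : 0 ≤ ε)
    (h1 : g 1 = 0) (hq : g q = Real.log q)
    (hg : ∀ y ∈ Set.Icc q 1, |g y - Real.log y| ≤ ε) (M : ℕ) :
    ∀ z ∈ Set.Icc (q ^ M) 1,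
      |∑ l ∈ Finset.range M, g (max q (min (z / q ^ l) 1)) - Real.log z| ≤ ε := by
  induction M with
  | zero =>
    intro z hz
    have : z = 1 := le_antisymm hz.2 (by simpa using hz.1)
    simpa [this] using hε
  | succ M ih =>
    intro z hz
    have hz0 : 0 < z := lt_of_lt_of_le (pow_pos hq0 _) hz.1
    rw [Finset.sum_range_succ']
    simp only [pow_zero, div_one]
    rcases le_total z q with h | h
    · have hzq : z / q ∈ Set.Icc (q ^ M) 1 :=
        ⟨by rw [le_div_iff₀ hq0, ← pow_succ]; exact hz.1, by rwa [div_le_one hq0]⟩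
      have := ih _ hzq
      rw [Real.log_div hz0.ne' hq0.ne'] at this
      rw [max_eq_left (le_trans (min_le_left _ _) h), hq]
      have heq : ∀ l, z / q ^ (l + 1) = z / q / q ^ l := by
        intro l; rw [pow_succ', div_div]
      simp only [heq]
      convert this using 2
      ring
    · rw [min_eq_left hz.2, max_eq_right h, Finset.sum_eq_zero, zero_add]
      · exact hg z ⟨h, hz.2⟩
      · intro l _
        have : 1 ≤ z / q ^ (l + 1) := by
          rw [one_le_div (pow_pos hq0 _), pow_succ]
          exact le_trans (mul_le_of_le_one_left hq0.le (pow_le_one₀ hq0.le hq1)) h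
        rw [min_eq_right this, max_eq_right hq1, h1]

/-! ### Approximation of the logarithm on one piece -/

/-- The powers `(1 - lᵢ s) ^ p` of `p + 1` different affine functions span the polynomials of degree
at most `p`, by the invertibility of the Vandermonde matrix. In particular the Taylor polynomial of
`log (1 - s)` is a linear combination of them. -/
theorem exists_sum_pow_eq_taylor (p : ℕ) :
    ∃ l c : Fin (p + 1) → ℝ, (∀ i, l i ∈ Set.Icc (0 : ℝ) (1 / 2)) ∧
      ∀ s : ℝ, ∑ i, c i * (1 - l i * s) ^ p = -∑ k ∈ Finset.range p, s ^ (k + 1) / (k + 1) := by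
  let l : Fin (p + 1) → ℝ := fun i => (i : ℝ) / (2 * (p + 1))
  have hinj : Function.Injective l := by
    intro i j h
    have hp : (2 * ((p : ℝ) + 1)) ≠ 0 := by positivity
    have h' : ((i : ℕ) : ℝ) = ((j : ℕ) : ℝ) := by
      simpa [l, div_left_inj' hp] using h
    exact Fin.ext (by exact_mod_cast h')
  -- Prescribed moments `∑ i, c i * l i ^ k`; the value at `k = 0` is `0` because `0⁻¹ = 0`.
  let d : Fin (p + 1) → ℝ := fun k => -((k : ℝ)⁻¹ * ((-1) ^ (k : ℕ) * (p.choose k : ℝ))⁻¹)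
  have hdet : IsUnit ((Matrix.vandermonde l).transpose).det := by
    rw [Matrix.det_transpose, isUnit_iff_ne_zero]
    exact Matrix.det_vandermonde_ne_zero_iff.mpr hinj
  let c := ((Matrix.vandermonde l).transpose)⁻¹.mulVec d
  have hc : ∀ k : Fin (p + 1), ∑ i, l i ^ (k : ℕ) * c i = d k := by
    intro k
    have : (Matrix.vandermonde l).transpose.mulVec c = d := by
      simp only [c, Matrix.mulVec_mulVec]
      rw [Matrix.mul_nonsing_inv _ hdet, Matrix.one_mulVec]
    have := congrFun this k
    simpa [Matrix.mulVec, dotProduct, Matrix.vandermonde] using this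
  refine ⟨l, c, fun i => ⟨by positivity, ?_⟩, fun s => ?_⟩
  · have hi : ((i : ℕ) : ℝ) ≤ p := by exact_mod_cast Nat.lt_succ_iff.mp i.2
    simp only [l]
    rw [div_le_div_iff₀ (by positivity) (by norm_num)]
    linarith
  · have h1 : ∀ i, c i * (1 - l i * s) ^ p
        = ∑ k : Fin (p + 1),
          (l i ^ (k : ℕ) * c i) * ((-1) ^ (k : ℕ) * (p.choose k) * s ^ (k : ℕ)) := by
      intro i
      rw [sub_eq_neg_add, add_pow, Finset.sum_range, Finset.mul_sum]
      refine Finset.sum_congr rfl fun k _ => ?_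
      rw [neg_pow, mul_pow]
      ring
    simp only [h1]
    rw [Finset.sum_comm]
    simp only [← Finset.sum_mul, hc]
    rw [Fin.sum_univ_succ, ← Finset.sum_neg_distrib, Finset.sum_range]
    have h0 : d 0 = 0 := by simp [d]
    rw [h0, zero_mul, zero_add]
    refine Finset.sum_congr rfl fun k _ => ?_
    have hch : ((p.choose ((k : ℕ) + 1) : ℕ) : ℝ) ≠ 0 :=
      Nat.cast_ne_zero.mpr (Nat.choose_pos (by have := k.2; omega)).ne'
    have hs : ((-1 : ℝ)) ^ ((k : ℕ) + 1) ≠ 0 := pow_ne_zero _ (by norm_num)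
    have hk : ((k : ℕ) : ℝ) + 1 ≠ 0 := by positivity
    simp only [d, Fin.val_succ]
    push_cast
    field_simp

/-- The Taylor polynomial of `log (1 - s)` with its powers replaced by iterated approximate squares.
The coefficients and the constant do not depend on the number `n` of bits. They sum to zero, which
makes the approximation exact at `s = 0`, where all approximate powers equal one. -/
theorem exists_abs_sum_iterate_sub_log_le (r : ℕ) :
    ∃ (l c : Fin (2 ^ r + 1) → ℝ) (C : ℝ), 0 < C ∧ (∀ i, l i ∈ Set.Icc (0 : ℝ) (1 / 2)) ∧
      (∀ i, |c i| ≤ C) ∧ ∑ i, c i = 0 ∧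
      ∀ (n : ℕ), ∀ s ∈ Set.Icc (0 : ℝ) (1 / 2),
        |∑ i, c i * (sqApprox n)^[r] (1 - l i * s) - Real.log (1 - s)|
          ≤ 2 * s ^ (2 ^ r + 1) + C * (1 / 4) ^ n := by
  obtain ⟨l, c, hl, hc⟩ := exists_sum_pow_eq_taylor (2 ^ r)
  have hp : (1 : ℝ) ≤ 2 ^ r := one_le_pow₀ (by norm_num)
  have hS : 0 ≤ ∑ i, |c i| := Finset.sum_nonneg fun i _ => abs_nonneg _
  refine ⟨l, c, (∑ i, |c i|) * 2 ^ r + 1, by positivity, hl, fun i => ?_, ?_, fun n s hs => ?_⟩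
  · have := Finset.single_le_sum (f := fun i => |c i|) (fun i _ => abs_nonneg _)
      (Finset.mem_univ i)
    nlinarith
  · simpa using hc 0
  · have hs1 : |s| < 1 := by rw [abs_of_nonneg hs.1]; linarith [hs.2]
    have hT := Real.abs_log_sub_add_sum_range_le hs1 (2 ^ r)
    rw [abs_of_nonneg hs.1] at hT
    have hT2 : s ^ (2 ^ r + 1) / (1 - s) ≤ 2 * s ^ (2 ^ r + 1) := by
      rw [div_le_iff₀ (by linarith [hs.2])]
      have : 0 ≤ s ^ (2 ^ r + 1) := pow_nonneg hs.1 _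
      nlinarith [hs.2]
    have hE : |∑ i, c i * (sqApprox n)^[r] (1 - l i * s) - ∑ i, c i * (1 - l i * s) ^ 2 ^ r|
        ≤ (∑ i, |c i|) * (2 ^ r * (1 / 4) ^ n) := by
      rw [← Finset.sum_sub_distrib, Finset.sum_mul]
      refine (Finset.abs_sum_le_sum_abs _ _).trans (Finset.sum_le_sum fun i _ => ?_)
      rw [← mul_sub, abs_mul]
      refine mul_le_mul_of_nonneg_left (abs_sqApprox_iterate_sub_pow_le ⟨?_, ?_⟩ n r)
        (abs_nonneg _)
      · nlinarith [(hl i).1, (hl i).2, hs.1, hs.2]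
      · linarith [mul_nonneg (hl i).1 hs.1]
    rw [hc s] at hE
    have h4 : (0 : ℝ) < (1 / 4) ^ n := by positivity
    rw [abs_le] at *
    constructor <;> nlinarith [hE.1, hE.2, hT.1, hT.2]

/-- An approximation `g` of the logarithm on `[q, 1]` becomes exact at `q` when it is multiplied by
`log q / g q`. This costs a relative error only. -/
theorem exists_rescale_exact {g : ℝ → ℝ} {q ε : ℝ} (hε : ε ∈ Set.Ioc (0 : ℝ) (1 / 2)) (hq0 : 0 < q)
    (hq1 : q < 1) (hlogq : -1 ≤ Real.log q)
    (herr : ∀ y ∈ Set.Icc q 1, |g y - Real.log y| ≤ ε / 4 * -Real.log q) :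
    ∃ θ : ℝ, |θ| ≤ 2 ∧ θ * g q = Real.log q ∧
      ∀ y ∈ Set.Icc q 1, |θ * g y - Real.log y| ≤ ε := by
  obtain ⟨hε0, hε1⟩ := hε
  have hℓ0 : 0 < -Real.log q := neg_pos.mpr (Real.log_neg hq0 hq1)
  obtain ⟨ℓ, hℓ⟩ : ∃ ℓ, ℓ = -Real.log q := ⟨_, rfl⟩
  have hlog : Real.log q = -ℓ := by rw [hℓ, neg_neg]
  rw [← hℓ] at hℓ0 herr
  have hgq := herr q ⟨le_rfl, hq1.le⟩
  rw [hlog, abs_le] at hgq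
  have hεℓ : ε * ℓ ≤ 1 / 2 * ℓ := by gcongr
  have hgq1 : g q ≤ -(ℓ * (7 / 8)) := by linarith [hgq.2]
  have hgq0 : g q < 0 := by linarith
  obtain ⟨θ, hθ⟩ : ∃ θ, θ = -ℓ / g q := ⟨_, rfl⟩
  have hθg : θ * g q = -ℓ := by rw [hθ]; exact div_mul_cancel₀ _ hgq0.ne
  have hθ1 : |θ - 1| ≤ ε / 3 := by
    have h1 : (θ - 1) * g q = -ℓ - g q := by rw [sub_mul, hθg]; ring
    have h2 : |θ - 1| * |g q| ≤ ε / 4 * ℓ := by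
      rw [← abs_mul, h1, abs_le]
      constructor <;> linarith [hgq.1, hgq.2]
    rw [abs_of_neg hgq0] at h2
    have h3 : |θ - 1| * (ℓ * (7 / 8)) ≤ |θ - 1| * -g q := by gcongr; linarith
    have h4 : |θ - 1| * (7 / 8) ≤ ε / 4 := by
      refine le_of_mul_le_mul_right ?_ hℓ0
      linarith
    linarith [abs_nonneg (θ - 1)]
  refine ⟨θ, ?_, by rw [hθg, hlog], fun y hy => ?_⟩
  · rw [abs_le] at hθ1 ⊢
    constructor <;> linarith [hθ1.1, hθ1.2]
  · have h1 := herr y hy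
    have h2 : |Real.log y| ≤ 1 := by
      have h3 : Real.log y ≤ 0 := Real.log_nonpos (by linarith [hy.1]) hy.2
      have h4 : Real.log q ≤ Real.log y := Real.log_le_log hq0 hy.1
      rw [abs_of_nonpos h3]
      linarith
    have h3 : ε / 4 * ℓ ≤ ε / 4 := mul_le_of_le_one_right (by linarith) (by linarith)
    have h4 : |g y| ≤ 9 / 8 := by
      have := abs_sub_abs_le_abs_sub (g y) (Real.log y)
      linarith
    calc |θ * g y - Real.log y| = |(θ - 1) * g y + (g y - Real.log y)| := by ring_nf
      _ ≤ |θ - 1| * |g y| + |g y - Real.log y| := by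
          rw [← abs_mul]; exact abs_add_le _ _
      _ ≤ ε / 3 * (9 / 8) + ε / 4 := by
          gcongr
          exact h1.trans h3
      _ ≤ ε := by linarith

/-- Approximation of the logarithm on one piece `[q, 1]` with `q = 2 ^ (-1 / N)`: the Taylor error
is `O(N ^ (-2 ^ r - 1))`, so `N` of order `ε ^ (-1 / 2 ^ r)` makes it small even relative to the
length `log 2 / N` of the piece on the logarithmic scale. -/
theorem exists_local_log_approx (r : ℕ) :
    ∃ (l : Fin (2 ^ r + 1) → ℝ) (C : ℝ), 1 ≤ C ∧ (∀ i, l i ∈ Set.Icc (0 : ℝ) (1 / 2)) ∧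
      ∀ ε ∈ Set.Ioc (0 : ℝ) (1 / 2), ∃ (N n : ℕ) (c : Fin (2 ^ r + 1) → ℝ) (q : ℝ),
        0 < N ∧ (N : ℝ) ≤ C * (1 / ε) ^ (1 / (2 ^ r : ℝ)) ∧ (n : ℝ) ≤ C * Real.log (1 / ε) ∧
        0 < q ∧ q < 1 ∧ q ^ N = 1 / 2 ∧ (∀ i, |c i| ≤ C) ∧ ∑ i, c i = 0 ∧
        ∑ i, c i * (sqApprox n)^[r] (1 - l i * (1 - q)) = Real.log q ∧
        ∀ y ∈ Set.Icc q 1,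
          |∑ i, c i * (sqApprox n)^[r] (1 - l i * (1 - y)) - Real.log y| ≤ ε := by
  obtain ⟨l, c, C, hC, hl, hcC, hc0, hmain⟩ := exists_abs_sum_iterate_sub_log_le r
  obtain ⟨p, hpdef⟩ : ∃ p : ℕ, p = 2 ^ r := ⟨_, rfl⟩
  have hp1 : 1 ≤ p := hpdef ▸ Nat.one_le_two_pow
  have hp0 : p ≠ 0 := by omega
  have hpR : (2 : ℝ) ^ r = (p : ℝ) := by rw [hpdef]; push_cast; rfl
  have hlog2 := Real.log_two_gt_d9
  have hlog2' := Real.log_two_lt_d9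
  refine ⟨l, max (max 25 (2 * C)) (4 + (|Real.log (400 * C)| + 1) * 2),
    le_trans (by norm_num) ((le_max_left (25 : ℝ) _).trans (le_max_left _ _)), hl, ?_⟩
  rintro ε ⟨hε0, hε1⟩
  have hinv : 2 ≤ 1 / ε := by rw [le_div_iff₀ hε0]; linarith
  have hlogε : Real.log 2 ≤ Real.log (1 / ε) := Real.log_le_log (by norm_num) hinv
  have hL0 : 0 ≤ Real.log (1 / ε) := by linarith
  have hroot : ∀ x : ℝ, 1 ≤ x → x ^ (1 / (p : ℝ)) ≤ x := by
    intro x hx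
    calc x ^ (1 / (p : ℝ)) ≤ x ^ (1 : ℝ) := by
          refine Real.rpow_le_rpow_of_exponent_le hx ?_
          rw [div_le_one (by positivity)]
          exact_mod_cast hp1
      _ = x := Real.rpow_one x
  -- The number of pieces: `24 / ε ≤ N ^ p`.
  set N := ⌈(24 * (1 / ε)) ^ (1 / (p : ℝ))⌉₊ with hN
  have hbase : (1 : ℝ) ≤ (1 / ε) ^ (1 / (p : ℝ)) :=
    Real.one_le_rpow (by linarith) (by positivity)
  have hb24 : (24 * (1 / ε)) ^ (1 / (p : ℝ)) ≤ 24 * (1 / ε) ^ (1 / (p : ℝ)) := by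
    rw [Real.mul_rpow (by norm_num) (by positivity)]
    gcongr
    exact hroot 24 (by norm_num)
  have hNle : (N : ℝ) ≤ 25 * (1 / ε) ^ (1 / (p : ℝ)) := by
    have := (Nat.ceil_lt_add_one (a := (24 * (1 / ε)) ^ (1 / (p : ℝ))) (by positivity)).le
    rw [← hN] at this
    linarith
  have hNpow : 24 * (1 / ε) ≤ (N : ℝ) ^ p := by
    have h1 : (24 * (1 / ε)) ^ (1 / (p : ℝ)) ≤ N := Nat.le_ceil _
    calc 24 * (1 / ε) = ((24 * (1 / ε)) ^ (1 / (p : ℝ))) ^ p := by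
          rw [one_div (p : ℝ), Real.rpow_inv_natCast_pow (by positivity) hp0]
      _ ≤ (N : ℝ) ^ p := by gcongr
  have hNpos : 0 < N := Nat.ceil_pos.mpr (by positivity)
  have hN1 : (1 : ℝ) ≤ N := by exact_mod_cast hNpos
  have hNε : (N : ℝ) ≤ 25 * (1 / ε) := by
    refine hNle.trans ?_
    gcongr
    exact hroot _ (by linarith)
  -- The number of bits: `400 C / ε² ≤ 4 ^ n`.
  set n := ⌈|Real.log (400 * C)| + 2 * Real.log (1 / ε)⌉₊ with hn
  have hn1 : |Real.log (400 * C)| + 2 * Real.log (1 / ε) ≤ n := Nat.le_ceil _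
  have hn2 : (n : ℝ) ≤ |Real.log (400 * C)| + 2 * Real.log (1 / ε) + 1 :=
    (Nat.ceil_lt_add_one (by positivity)).le
  have h4n : 400 * C * (1 / ε) ^ 2 ≤ 4 ^ n := by
    calc 400 * C * (1 / ε) ^ 2
        = Real.exp (Real.log (400 * C) + 2 * Real.log (1 / ε)) := by
          rw [Real.exp_add, Real.exp_log (by positivity), two_mul, Real.exp_add,
            Real.exp_log (by positivity)]
          ring
      _ ≤ Real.exp n := Real.exp_le_exp.mpr (by linarith [le_abs_self (Real.log (400 * C))])
      _ = Real.exp 1 ^ n := by rw [← Real.exp_nat_mul, mul_one]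
      _ ≤ 4 ^ n := by gcongr; linarith [Real.exp_one_lt_d9]
  -- The piece.
  set q := Real.exp (-(Real.log 2 / N)) with hqdef
  have hlogq : Real.log q = -(Real.log 2 / N) := Real.log_exp _
  have hℓ0 : 0 < Real.log 2 / N := by positivity
  have hq0 : 0 < q := Real.exp_pos _
  have hq1 : q < 1 := by rw [hqdef, Real.exp_lt_one_iff]; linarith
  have hqN : q ^ N = 1 / 2 := by
    rw [hqdef, ← Real.exp_nat_mul, mul_neg, mul_div_cancel₀ _ (by positivity), Real.exp_neg,
      Real.exp_log (by norm_num), one_div]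
  have hqhalf : 1 / 2 ≤ q := by
    rw [← hqN]; exact pow_le_of_le_one hq0.le hq1.le hNpos.ne'
  have hqs : 1 - q ≤ 1 / N := by
    have h1 := Real.add_one_le_exp (-(Real.log 2 / N))
    have h2 : Real.log 2 / N ≤ 1 / N := by gcongr; linarith
    linarith
  -- Uniform error on the piece, relative to its logarithmic length.
  have herr : ∀ y ∈ Set.Icc q 1,
      |∑ i, c i * (sqApprox n)^[r] (1 - l i * (1 - y)) - Real.log y|
        ≤ ε / 4 * (Real.log 2 / N) := by
    rintro y ⟨hy0, hy1⟩
    have h := hmain n (1 - y) ⟨by linarith, by linarith⟩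
    rw [sub_sub_cancel] at h
    refine h.trans ?_
    simp only [← hpdef]
    have hE1 : 2 * (1 - y) ^ (p + 1) ≤ ε / 12 / N := by
      calc 2 * (1 - y) ^ (p + 1) ≤ 2 * (1 / N) ^ (p + 1) := by
            gcongr
            linarith
        _ = 2 / N ^ p / N := by rw [one_div, inv_pow, pow_succ]; field_simp
        _ ≤ ε / 12 / N := by
            refine div_le_div_of_nonneg_right ?_ (by positivity)
            rw [div_le_iff₀ (by positivity)]
            calc (2 : ℝ) = ε / 12 * (24 * (1 / ε)) := by field_simp; norm_num
              _ ≤ ε / 12 * (N : ℝ) ^ p := by gcongr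
    have hE2 : C * (1 / 4) ^ n ≤ ε / 16 / N := by
      rw [one_div_pow, mul_one_div, div_div, div_le_div_iff₀ (by positivity) (by positivity)]
      calc C * (16 * N) ≤ C * (16 * (25 * (1 / ε))) := by gcongr
        _ = ε * (400 * C * (1 / ε) ^ 2) := by field_simp; norm_num
        _ ≤ ε * 4 ^ n := by gcongr
    have hfin : ε / 12 / N + ε / 16 / N ≤ ε / 4 * (Real.log 2 / N) := by
      rw [← add_div, mul_div_assoc']
      gcongr
      nlinarith
    linarith
  obtain ⟨θ, hθ2, hθq, hθ⟩ := exists_rescale_exact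
    (g := fun y => ∑ i, c i * (sqApprox n)^[r] (1 - l i * (1 - y))) ⟨hε0, hε1⟩ hq0 hq1
    (by rw [hlogq, neg_le_neg_iff, div_le_one (by positivity)]; linarith)
    (by rw [hlogq, neg_neg]; exact herr)
  have hsum : ∀ y, ∑ i, θ * c i * (sqApprox n)^[r] (1 - l i * (1 - y))
      = θ * ∑ i, c i * (sqApprox n)^[r] (1 - l i * (1 - y)) := by
    intro y
    rw [Finset.mul_sum]
    exact Finset.sum_congr rfl fun i _ => by ring
  refine ⟨N, n, fun i => θ * c i, q, hNpos, ?_, ?_, hq0, hq1, hqN, ?_, ?_, ?_, ?_⟩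
  · rw [hpR]
    refine hNle.trans ?_
    gcongr
    exact (le_max_left _ _).trans (le_max_left _ _)
  · have h1 : (|Real.log (400 * C)| + 1) * (1 / 2)
        ≤ (|Real.log (400 * C)| + 1) * Real.log (1 / ε) := by
      gcongr
      linarith
    calc (n : ℝ) ≤ (4 + (|Real.log (400 * C)| + 1) * 2) * Real.log (1 / ε) := by
          rw [add_mul, mul_right_comm]
          linarith only [h1, hn2, hL0]
      _ ≤ _ := by
          gcongr
          exact le_max_right _ _
  · intro i
    rw [abs_mul]
    calc |θ| * |c i| ≤ 2 * C := by gcongr; exact hcC i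
      _ ≤ _ := (le_max_right _ _).trans (le_max_left _ _)
  · rw [← Finset.mul_sum, hc0, mul_zero]
  · rw [hsum, hθq]
  · intro y hy
    rw [hsum]
    exact hθ y hy

/-! ### Sparse description of networks -/

theorem enorm_le_one_of_abs_le_one {t : ℝ} (h : |t| ≤ 1) : ‖t‖ₑ ≤ 1 := by
  rw [Real.enorm_eq_ofReal_abs]
  exact ENNReal.ofReal_le_one.mpr h

/-- `Computes w L s ι F`: the functions `F i`, `i : ι`, of one real variable are the values of the
neurons in the `L`-th hidden layer of a ReLU network of width at most `w`, whose first `L` hidden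
layers have at most `s` nonzero parameters, all of them bounded by one. The neurons are labelled by
an arbitrary type, and a layer is described sparsely: the neuron `k` receives the values of the
neurons `src k t`, `t : T`, with weights `wt k t`, and has the shift `v k`. -/
inductive Computes (w : ℕ) : ℕ → ℕ → (ι : Type) → (ι → ℝ → ℝ) → Prop
  | input : Computes w 0 0 Unit (fun _ x => x)
  | layer {L s : ℕ} {ι : Type} {F : ι → ℝ → ℝ} (h : Computes w L s ι F)
      {κ T : Type} [Fintype κ] [Fintype T] [Nonempty κ]
      (src : κ → T → ι) (hsrc : ∀ k, Function.Injective (src k))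
      (wt : κ → T → ℝ) (hwt : ∀ k t, |wt k t| ≤ 1) (v : κ → ℝ) (hv : ∀ k, |v k| ≤ 1)
      (hκ : Fintype.card κ ≤ w) :
      Computes w (L + 1) (s + Fintype.card κ * (Fintype.card T + 1)) κ
        (fun k x => relu (∑ t, wt k t * F (src k t) x - v k))

namespace Computes

theorem congr {w L s L' s' : ℕ} {ι : Type} {F G : ι → ℝ → ℝ} (h : Computes w L s ι F)
    (hL : L = L') (hs : s = s') (hFG : ∀ i x, F i x = G i x) : Computes w L' s' ι G := by
  have : F = G := by ext i x; exact hFG i x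
  subst hL hs this
  exact h

/-- `ReLUNet` lists the layers from the input to the output, while `Computes` adds layers at the
output side. Hence the claim is made for an arbitrary continuation `rest` of the network. -/
theorem exists_net {w L s : ℕ} {ι : Type} {F : ι → ℝ → ℝ} (h : Computes w L s ι F) :
    ∃ (m : ℕ) (e : ι ≃ Fin m), ∀ rest : ReLUNet 1 m, ∃ net : ReLUNet 1 1,
      (∀ x, net.eval x = rest.eval fun i => F (e.symm i) (x 0)) ∧
      net.depth = L + rest.depth ∧ net.width ≤ max w rest.width ∧
      net.numNonzero ≤ s + rest.numNonzero ∧ net.paramSup ≤ max 1 rest.paramSup := by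
  induction h with
  | input =>
    refine ⟨1, Equiv.ofUnique _ _, fun rest => ⟨rest, fun x => ?_, by simp, by simp, by simp,
      by simp⟩⟩
    congr 1
    ext i
    rw [Subsingleton.elim i 0]
  | @layer L s ι F h κ T _ _ _ src hsrc wt hwt v hv hκ ih =>
    obtain ⟨m, e, ih⟩ := ih
    let e' := Fintype.equivFin κ
    let W : Matrix (Fin (Fintype.card κ)) (Fin m) ℝ := fun k i =>
      ∑ t, if e (src (e'.symm k) t) = i then wt (e'.symm k) t else 0
    have hWv : ∀ (y : ι → ℝ) k, W.mulVec (fun i => y (e.symm i)) k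
        = ∑ t, wt (e'.symm k) t * y (src (e'.symm k) t) := by
      intro y k
      simp only [Matrix.mulVec, dotProduct, W, Finset.sum_mul]
      rw [Finset.sum_comm]
      refine Finset.sum_congr rfl fun t _ => ?_
      simp [ite_mul]
    have hW1 : ∀ k i, |W k i| ≤ 1 := by
      intro k i
      by_cases hex : ∃ t, e (src (e'.symm k) t) = i
      · obtain ⟨t, rfl⟩ := hex
        have hWt : W k (e (src (e'.symm k) t)) = wt (e'.symm k) t := by
          change ∑ t', (if e (src (e'.symm k) t') = _ then wt (e'.symm k) t' else 0) = _
          rw [Finset.sum_eq_single t (fun b _ hb => if_neg fun h => hb (hsrc _ (e.injective h)))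
            (by simp), if_pos rfl]
        rw [hWt]
        exact hwt _ _
      · push Not at hex
        simp [W, hex]
    have hnnz : matNNZ W ≤ Fintype.card κ * Fintype.card T := by
      have hsub : (Finset.univ.filter fun ij : Fin (Fintype.card κ) × Fin m =>
          W ij.1 ij.2 ≠ 0) ⊆ (Finset.univ : Finset (κ × T)).image
            (fun kt => (e' kt.1, e (src kt.1 kt.2))) := by
        rintro ⟨k, i⟩ hki
        simp only [Finset.mem_filter, Finset.mem_univ, true_and] at hki
        obtain ⟨t, -, ht⟩ := Finset.exists_ne_zero_of_sum_ne_zero hki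
        have ht' : e (src (e'.symm k) t) = i := by
          by_contra hcon
          exact ht (if_neg hcon)
        simp only [Finset.mem_image, Finset.mem_univ, true_and, Prod.exists, Prod.mk.injEq]
        exact ⟨e'.symm k, t, by simp, ht'⟩
      refine (Finset.card_le_card hsub).trans (Finset.card_image_le.trans ?_)
      rw [Finset.card_univ, Fintype.card_prod]
    have hvnz : vecNNZ (fun k => v (e'.symm k)) ≤ Fintype.card κ := by
      refine (Finset.card_filter_le _ _).trans ?_
      simp
    refine ⟨Fintype.card κ, e', fun rest => ?_⟩
    obtain ⟨net, h1, h2, h3, h4, h5⟩ :=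
      ih (ReLUNet.hidden Fintype.card_pos W (fun k => v (e'.symm k)) rest)
    refine ⟨net, fun x => ?_, ?_, ?_, ?_, ?_⟩
    · rw [h1, ReLUNet.eval]
      simp only [hWv fun i => F i (x 0)]
    · rw [h2, ReLUNet.depth]; ring
    · rw [ReLUNet.width] at h3
      refine h3.trans (max_le (le_max_left _ _) (max_le (hκ.trans (le_max_left _ _))
        (le_max_right _ _)))
    · rw [ReLUNet.numNonzero] at h4
      rw [Nat.mul_add, Nat.mul_one]
      omega
    · rw [ReLUNet.paramSup] at h5
      refine h5.trans (max_le (le_max_left _ _) (max_le ((max_le ?_ ?_).trans (le_max_left _ _))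
        (le_max_right _ _)))
      · exact iSup_le fun k => iSup_le fun i => enorm_le_one_of_abs_le_one (hW1 k i)
      · exact iSup_le fun k => enorm_le_one_of_abs_le_one (hv _)

theorem mem_FNN {w L s : ℕ} {ι : Type} [Fintype ι] {F : ι → ℝ → ℝ} (h : Computes w L s ι F)
    (u : ι → ℝ) (hu : ∀ i, |u i| ≤ 1) {G N : ℝ} {S : ℝ≥0∞} (hG : (L : ℝ) ≤ G)
    (hN : (w : ℝ) ≤ N) (hS : ((s + Fintype.card ι : ℕ) : ℝ≥0∞) ≤ S) :
    (fun x : Fin 1 → ℝ => ∑ i, u i * F i (x 0)) ∈ FNN 1 G N S 1 ⊤ := by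
  obtain ⟨m, e, hnet⟩ := h.exists_net
  obtain ⟨net, h1, h2, h3, h4, h5⟩ := hnet (ReLUNet.output (Matrix.of fun _ i => u (e.symm i)))
  have hm : Fintype.card ι = m := by rw [Fintype.card_congr e, Fintype.card_fin]
  refine ⟨net, fun x => ?_, ?_, ?_, ?_, ?_, le_top⟩
  · rw [h1, ReLUNet.eval]
    simp only [Matrix.mulVec, dotProduct, Matrix.of_apply]
    exact (e.symm.sum_comp fun i => u i * F i (x 0)).symm
  · rwa [h2, ReLUNet.depth, Nat.add_zero]
  · rw [ReLUNet.width, max_eq_left (Nat.zero_le _)] at h3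
    exact le_trans (by exact_mod_cast h3) hN
  · refine le_trans ?_ hS
    have : (ReLUNet.output (Matrix.of fun (_ : Fin 1) i => u (e.symm i))).numNonzero ≤ m := by
      rw [ReLUNet.numNonzero]
      refine (Finset.card_filter_le _ _).trans ?_
      simp
    exact_mod_cast h4.trans (by omega)
  · refine h5.trans (max_le le_rfl ?_)
    exact iSup_le fun k => iSup_le fun i => enorm_le_one_of_abs_le_one (hu _)

/-! ### The stages of the network -/

/-- The state of the squaring network consists of the scaled iterated tent map, its second ReLU and
the current approximation of the square. -/
theorem sqState {w L s : ℕ} {ι : Type} [Fintype ι] [Nonempty ι] {F : ι → ℝ → ℝ}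
    (h : Computes w L s ι F) (hF : ∀ i x, F i x ∈ Set.Icc (0 : ℝ) 1)
    (hw : Fintype.card ι * 3 ≤ w) (n : ℕ) :
    Computes w (L + (n + 1)) (s + Fintype.card ι * 6 + n * (Fintype.card ι * 12)) (ι × Fin 3)
      (fun k x => ![scaledTent n (F k.1 x), relu (scaledTent n (F k.1 x) - (1 / 4) ^ n / 2),
        sqApprox n (F k.1 x)] k.2) := by
  induction n with
  | zero =>
    refine (h.layer (κ := ι × Fin 3) (T := Unit) (fun k _ => k.1)
      (fun _ => Function.injective_of_subsingleton _) (fun _ _ => 1) (by simp)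
      (fun k => ![0, 1 / 2, 0] k.2) ?_ (by simpa using hw)).congr (by omega) ?_ ?_
    · rintro ⟨i, j⟩
      fin_cases j <;> norm_num [abs_le]
    · simp only [Fintype.card_prod, Fintype.card_fin, Fintype.card_unit]; ring
    · rintro ⟨i, j⟩ x
      have := (hF i x).1
      fin_cases j <;> simp [scaledTent, sqApprox, relu_of_nonneg this]
  | succ n ih =>
    refine (ih.layer (κ := ι × Fin 3) (T := Fin 3) (fun k t => (k.1, t))
      (fun _ _ _ h => (Prod.mk.inj h).2)
      (fun k t => (![![1 / 2, -1, 0], ![1 / 2, -1, 0], ![-1 / 2, 1, 1]] : Fin 3 → Fin 3 → ℝ) k.2 t)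
      ?_ (fun k => ![0, (1 / 4) ^ (n + 1) / 2, 0] k.2) ?_ (by simpa using hw)).congr
      (by omega) ?_ ?_
    · rintro ⟨i, j⟩ t
      fin_cases j <;> fin_cases t <;> norm_num [abs_le]
    · rintro ⟨i, j⟩
      have h1 : (1 / 4 : ℝ) ^ (n + 1) ≤ 1 := pow_le_one₀ (by norm_num) (by norm_num)
      have h2 : (0 : ℝ) ≤ (1 / 4 : ℝ) ^ (n + 1) := by positivity
      fin_cases j
      · simp
      · change |(1 / 4 : ℝ) ^ (n + 1) / 2| ≤ 1
        rw [abs_of_nonneg (by positivity)]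
        linarith
      · simp
    · simp only [Fintype.card_prod, Fintype.card_fin]; ring
    · rintro ⟨i, j⟩ x
      have h1 := (scaledTent_mem (hF i x) (n + 1)).1
      have h2 := (sqApprox_mem (hF i x) (n + 1)).1
      have h3 : scaledTent (n + 1) (F i x) = scaledTent n (F i x) / 2
        - relu (scaledTent n (F i x) - (1 / 4) ^ n / 2) := rfl
      have h4 : sqApprox (n + 1) (F i x) = sqApprox n (F i x) - scaledTent (n + 1) (F i x) := rfl
      fin_cases j
      · simp only [Fin.sum_univ_three]
        rw [← relu_of_nonneg h1, h3]
        simp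
        ring_nf
      · simp only [Fin.sum_univ_three]
        change relu _ = relu _
        rw [h3]
        simp
        ring_nf
      · simp only [Fin.sum_univ_three]
        change relu _ = sqApprox (n + 1) (F i x)
        rw [← relu_of_nonneg h2, h4, h3]
        simp
        ring_nf

theorem sq {w L s : ℕ} {ι : Type} [Fintype ι] [Nonempty ι] {F : ι → ℝ → ℝ}
    (h : Computes w L s ι F) (hF : ∀ i x, F i x ∈ Set.Icc (0 : ℝ) 1)
    (hw : Fintype.card ι * 3 ≤ w) (n : ℕ) :
    Computes w (L + (n + 2)) (s + Fintype.card ι * (8 + n * 12)) ι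
      (fun i x => sqApprox n (F i x)) := by
  refine ((h.sqState hF hw n).layer (κ := ι) (T := Unit) (fun i _ => (i, 2))
    (fun _ => Function.injective_of_subsingleton _) (fun _ _ => 1) (by simp)
    (fun _ => 0) (by simp) (by omega)).congr (by omega) ?_ ?_
  · rw [Fintype.card_unit]; ring
  · intro i x
    simp [relu_of_nonneg (sqApprox_mem (hF i x) n).1]

theorem sq_iterate {w L s : ℕ} {ι : Type} [Fintype ι] [Nonempty ι] {F : ι → ℝ → ℝ}
    (h : Computes w L s ι F) (hF : ∀ i x, F i x ∈ Set.Icc (0 : ℝ) 1)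
    (hw : Fintype.card ι * 3 ≤ w) (n r : ℕ) :
    Computes w (L + r * (n + 2)) (s + r * (Fintype.card ι * (8 + n * 12))) ι
      (fun i x => (sqApprox n)^[r] (F i x)) := by
  induction r with
  | zero => exact h.congr (by simp) (by simp) fun _ _ => rfl
  | succ r ih =>
    refine (ih.sq (fun i x => sqApprox_iterate_mem (hF i x) n r) hw n).congr (by ring) (by ring) ?_
    intro i x
    rw [Function.iterate_succ_apply']

/-- All multiples `2 ^ k * x`, `k < K`, of the positive part of the input. Since weights are at most
one, doubling a value needs two neurons carrying it. -/
theorem double {w K : ℕ} [NeZero K] (hw : K * 2 ≤ w) (m : ℕ) :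
    Computes w (m + 1) (K * 4 + m * (K * 6)) (Fin K × Bool)
      (fun k x => 2 ^ min k.1.val m * relu x) := by
  induction m with
  | zero =>
    refine (Computes.input.layer (κ := Fin K × Bool) (T := Unit) (fun _ _ => ())
      (fun _ => Function.injective_of_subsingleton _) (fun _ _ => 1) (by simp) (fun _ => 0)
      (by simp) (by simpa using hw)).congr (by simp) ?_ ?_
    · simp only [Fintype.card_prod, Fintype.card_fin, Fintype.card_bool, Fintype.card_unit]; ring
    · intro k x; simp
  | succ m ih =>
    refine (ih.layer (κ := Fin K × Bool) (T := Bool) (fun k t => (k.1, t))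
      (fun _ _ _ h => (Prod.mk.inj h).2)
      (fun k t => if k.1.val ≤ m ∧ t = true then 0 else 1) ?_ (fun _ => 0) (by simp)
      (by simpa using hw)).congr (by simp) ?_ ?_
    · intro k t
      split_ifs <;> simp
    · simp only [Fintype.card_prod, Fintype.card_fin, Fintype.card_bool]; ring
    · rintro ⟨k, c⟩ x
      have hx := relu_nonneg x
      by_cases hk : k.val ≤ m
      · have h1 : 0 ≤ 2 ^ k.val * relu x := by positivity
        simp [hk, show k.val ≤ m + 1 by omega, relu_of_nonneg h1]
      · have h1 : min k.val (m + 1) = m + 1 := by omega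
        have h2 : min k.val m = m := by omega
        simp only [hk, false_and, if_false, h1, h2, Fintype.sum_bool, one_mul, sub_zero]
        rw [relu_of_nonneg (by positivity)]
        ring

/-- The affine functions `1 - lᵢ (1 - y)` of the clipped rescalings `y` of the input. -/
theorem affine_clip {w K N : ℕ} [NeZero K] [NeZero N] {P : Type} [Fintype P] [Nonempty P]
    {l : P → ℝ} (hl : ∀ i, l i ∈ Set.Icc (0 : ℝ) (1 / 2)) {q : ℝ} (hq0 : 0 < q) (hq1 : q < 1)
    (hqN : q ^ N = 1 / 2) (hw : K * N * (2 * Fintype.card P) ≤ w) :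
    Computes w (K + 3) (K * 4 + K * (K * 6) + K * N * 4 + K * N * Fintype.card P * 3)
      (Fin (K * N) × P)
      (fun k x => 1 - l k.2 * (1 - max q (min (relu x / q ^ k.1.val) 1))) := by
  have hP : 0 < Fintype.card P := Fintype.card_pos
  have hN : 0 < N := NeZero.pos N
  have hK : 0 < K := NeZero.pos K
  have : Nonempty (Fin (K * N)) := ⟨⟨0, by positivity⟩⟩
  have hw2 : K * N * 2 ≤ w := le_trans (Nat.mul_le_mul_left _ (by omega)) hw
  have hw1 : K * 2 ≤ w := (Nat.mul_le_mul_right 2 (Nat.le_mul_of_pos_right K hN)).trans hw2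
  have hw3 : K * N * Fintype.card P ≤ w := le_trans (Nat.mul_le_mul_left _ (by omega)) hw
  have hdiv : ∀ a : Fin (K * N), a.val / N < K := fun a => 
    Nat.div_lt_of_lt_mul (a.2.trans_eq (mul_comm _ _))
  -- Since `q ^ N = 1 / 2`, dividing by `q ^ a` means multiplying by `2 ^ (a / N)` and dividing by
  -- `q ^ (a % N) ≥ 1 / 2`; the latter fits into the weights because `l i ≤ 1 / 2`.
  have hmod : ∀ a : Fin (K * N),
      q ^ (a.val % N) * (2 ^ (a.val / N) * q ^ a.val) = (q ^ (a.val % N)) ^ 2 := by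
    intro a
    have h1 : q ^ a.val = q ^ (a.val % N) * (1 / 2) ^ (a.val / N) := by
      rw [← hqN, ← pow_mul, ← pow_add, Nat.mod_add_div]
    have h2 : (2 : ℝ) ^ (a.val / N) * (1 / 2) ^ (a.val / N) = 1 := by
      rw [← mul_pow]; norm_num
    rw [h1]
    linear_combination (q ^ (a.val % N)) ^ 2 * h2
  have hpow1 : ∀ a : ℕ, |q ^ a| ≤ 1 := fun a => by
    rw [abs_of_pos (pow_pos hq0 _)]; exact pow_le_one₀ hq0.le hq1.le
  -- `max q (min y 1) = q + relu (y - q) - relu (y - 1)`, up to the scaling by `q ^ (a % N)`.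
  have step1 := (double (K := K) hw1 K).layer (κ := Fin (K * N) × Bool) (T := Unit)
    (fun k _ => (⟨k.1.val / N, hdiv k.1⟩, false))
    (fun _ => Function.injective_of_subsingleton _) (fun _ _ => 1) (by simp)
    (fun k => q ^ (if k.2 = true then k.1.val % N else k.1.val % N + 1)) (fun k => hpow1 _)
    (by simpa using hw2)
  have hhalf : ∀ a : ℕ, 1 / 2 ≤ q ^ (a % N) := fun a => by
    rw [← hqN]; exact pow_le_pow_of_le_one hq0.le hq1.le (Nat.mod_lt a hN).le
  have step2 := step1.layer (κ := Fin (K * N) × P) (T := Bool) (fun k t => (k.1, t))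
    (fun _ _ _ h => (Prod.mk.inj h).2)
    (fun k t => (if t = true then -1 else 1) * (l k.2 / q ^ (k.1.val % N))) ?_
    (fun k => -(1 - l k.2 * (1 - q))) ?_ (by simpa using hw3)
  · refine step2.congr (by ring) ?_ ?_
    · simp only [Fintype.card_prod, Fintype.card_fin, Fintype.card_bool, Fintype.card_unit]
      ring
    · rintro ⟨a, i⟩ x
      have hx := relu_nonneg x
      obtain ⟨hl0, hl1⟩ := hl i
      have hmin : min (a.val / N) K = a.val / N := min_eq_left (hdiv a).le
      simp only [Fintype.sum_bool, Finset.univ_unique, Finset.sum_singleton, hmin]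
      have hQ : 0 < q ^ (a.val % N) := pow_pos hq0 _
      have hy : 2 ^ (a.val / N) * relu x = q ^ (a.val % N) * (relu x / q ^ a.val) := by
        have h := hmod a
        have h' : 2 ^ (a.val / N) * q ^ a.val = q ^ (a.val % N) := by
          apply mul_left_cancel₀ hQ.ne'; rw [h]; ring
        have : 0 < q ^ a.val := pow_pos hq0 _
        rw [← h']; field_simp
      rw [hy]
      set y := relu x / q ^ a.val
      set Q := q ^ (a.val % N)
      have hscale : ∀ u : ℝ, relu (Q * u) = Q * relu u := by
        intro u
        rw [relu, relu, mul_max_of_nonneg _ _ hQ.le, mul_zero]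
      have hA : relu (1 * (Q * y) - q ^ (a.val % N + 1)) = Q * relu (y - q) := by
        rw [← hscale, pow_succ]; congr 1; ring
      have hB : relu (1 * (Q * y) - Q) = Q * relu (y - 1) := by
        rw [← hscale]; congr 1; ring
      have hclip : max q (min y 1) = q + relu (y - q) - relu (y - 1) := by
        rcases le_total y q with h | h
        · rw [relu_of_nonpos (by linarith), relu_of_nonpos (by linarith),
            max_eq_left ((min_le_left _ _).trans h)]
          ring
        · rcases le_total y 1 with h' | h'
          · rw [relu_of_nonneg (by linarith), relu_of_nonpos (by linarith), min_eq_left h',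
              max_eq_right h]
            ring
          · rw [relu_of_nonneg (by linarith), relu_of_nonneg (by linarith), min_eq_right h',
              max_eq_right hq1.le]
            ring
      have hnn : 0 ≤ 1 - l i * (1 - max q (min y 1)) := by
        have := le_max_left q (min y 1)
        nlinarith
      rw [← relu_of_nonneg hnn, hclip]
      simp only [if_true, Bool.false_eq_true, if_false]
      rw [hA, hB]
      congr 1
      field_simp
      ring
  · rintro ⟨a, i⟩ t
    obtain ⟨hl0, hl1⟩ := hl i
    have h1 : |l i / q ^ (a.val % N)| ≤ 1 := by
      rw [abs_of_nonneg (div_nonneg hl0 (pow_pos hq0 _).le), div_le_one (pow_pos hq0 _)]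
      exact hl1.trans (hhalf _)
    rw [abs_mul]
    split_ifs <;> simpa using h1
  · rintro ⟨a, i⟩
    obtain ⟨hl0, hl1⟩ := hl i
    rw [abs_neg, abs_le]
    constructor <;> nlinarith

/-- The output stage: from a linear combination `Y` of the neurons, the clamped value
`-max A (min Y B)` for `0 ≤ A ≤ B`. As biases are at most one, the clamping is done for `Y / R`, and
`R` identical copies of it are added up. -/
theorem clamp {w L s : ℕ} {ι : Type} [Fintype ι] {F : ι → ℝ → ℝ}
    (h : Computes w L s ι F) {R : ℕ} [NeZero R] (c : ι → ℝ) (hc : ∀ i, |c i| ≤ R) {A B : ℝ}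
    (hA : 0 ≤ A) (hAB : A ≤ B) (hB : B ≤ R) (hw : R * 3 ≤ w) {G N : ℝ} {S : ℝ≥0∞}
    (hG : ((L + 2 : ℕ) : ℝ) ≤ G) (hN : (w : ℝ) ≤ N)
    (hS : ((s + Fintype.card ι + 1 + R * 9 : ℕ) : ℝ≥0∞) ≤ S) :
    (fun x : Fin 1 → ℝ => -max A (min (∑ i, c i * F i (x 0)) B)) ∈ FNN 1 G N S 1 ⊤ := by
  have hR : (0 : ℝ) < R := by exact_mod_cast NeZero.pos R
  have hR1 : 0 < R := NeZero.pos R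
  have step1 := h.layer (κ := Unit) (T := ι) (fun _ t => t) (fun _ => Function.injective_id)
    (fun _ t => c t / R)
    (fun _ t => by rw [abs_div, Nat.abs_cast, div_le_one hR]; exact hc t) (fun _ => 0) (by simp)
    (by rw [Fintype.card_unit]; omega)
  have step2 := step1.layer (κ := Fin R × Fin 3) (T := Unit) (fun _ _ => ())
    (fun _ => Function.injective_of_subsingleton _)
    (fun k _ => ![0, 1, 1] k.2) ?_ (fun k => ![-(A / R), A / R, B / R] k.2) ?_
    (by simpa using hw)
  · have := step2.mem_FNN (fun k => ![-1, -1, 1] k.2) ?_ (G := G) (N := N) (S := S)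
      (by exact_mod_cast hG) hN (le_trans ?_ hS)
    · convert this using 2 with x
      rw [Fintype.sum_prod_type]
      simp only [Finset.sum_const, Finset.card_univ, Fintype.card_fin,
        nsmul_eq_mul, Fin.sum_univ_three]
      set Y := ∑ i, c i * F i (x 0) with hY
      have hYR : ∑ i, c i / R * F i (x 0) = Y / R := by
        rw [hY, Finset.sum_div]; exact Finset.sum_congr rfl fun i _ => by ring
      have hscale : ∀ u : ℝ, R * relu u = relu (R * u) := by
        intro u; rw [relu, relu, mul_max_of_nonneg _ _ hR.le, mul_zero]
      have hcl : max A (min Y B) = A + relu (relu Y - A) - relu (relu Y - B) := by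
        rcases le_total Y A with h | h
        · have hr : relu Y ≤ A := max_le h hA
          rw [relu_of_nonpos (by linarith), relu_of_nonpos (by linarith),
            max_eq_left ((min_le_left _ _).trans h)]
          ring
        · rw [relu_of_nonneg (hA.trans h)]
          rcases le_total Y B with h' | h'
          · rw [relu_of_nonneg (by linarith), relu_of_nonpos (by linarith), min_eq_left h',
              max_eq_right h]
            ring
          · rw [relu_of_nonneg (by linarith), relu_of_nonneg (by linarith), min_eq_right h',
              max_eq_right hAB]
            ring
      rw [hcl]
      simp only [Matrix.cons_val_zero, Matrix.cons_val_one, Matrix.cons_val, hYR, sub_zero,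
        Fintype.card_unit, Nat.cast_one, zero_mul, one_mul, zero_sub, neg_neg]
      have e1 : R * relu (A / R) = A := by
        rw [hscale, mul_div_cancel₀ _ hR.ne', relu_of_nonneg hA]
      have e2 : ∀ D, R * relu (relu (Y / R) - D / R) = relu (relu Y - D) := by
        intro D
        rw [hscale, mul_sub, hscale, mul_div_cancel₀ _ hR.ne', mul_div_cancel₀ _ hR.ne']
      linear_combination e1 + e2 A - e2 B
    · rintro ⟨i, j⟩
      fin_cases j <;> simp
    · apply le_of_eq
      congr 1
      simp only [Fintype.card_prod, Fintype.card_fin, Fintype.card_unit]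
      ring
  · rintro ⟨i, j⟩ t
    fin_cases j <;> simp
  · have hA1 : |A / R| ≤ 1 := by
      rw [abs_of_nonneg (by positivity), div_le_one hR]; linarith
    have hB1 : |B / R| ≤ 1 := by
      rw [abs_of_nonneg (div_nonneg (hA.trans hAB) hR.le), div_le_one hR]; exact hB
    rintro ⟨i, j⟩
    fin_cases j
    · simpa using hA1
    · simpa using hA1
    · simpa using hB1

end Computes

/-! ### Choice of the parameters -/

theorem theorem2p4 (α : ℝ) (hα : 0 < α) :
    ∃ A₁ A₂ A₃ : ℝ, 0 < A₁ ∧ 0 < A₂ ∧ 0 < A₃ ∧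
      ∀ a b ε : ℝ, a ∈ Set.Ioc (0 : ℝ) (1 / 2) → b ∈ Set.Ioc a 1 →
        ε ∈ Set.Ioc (0 : ℝ) (1 / 2) →
        ∃ f : ℝ → ℝ,
          (fun x : Fin 1 → ℝ => f (x 0)) ∈
            FNN 1
              (A₁ * Real.log (1 / ε) + 139 * Real.log (1 / a))
              (A₂ * (1 / ε) ^ (1 / α) * Real.log (1 / a))
              (ENNReal.ofReal
                (A₃ * (1 / ε) ^ (1 / α) * Real.log (1 / ε) * Real.log (1 / a)
                  + 65440 * Real.log (1 / a) ^ 2))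
              1 ⊤ ∧
          (∀ z ∈ Set.Icc a b, |Real.log z - f z| ≤ ε) ∧
          (∀ t : ℝ, Real.log a ≤ f t ∧ f t ≤ Real.log b) := by
  -- A power of two as the degree only improves the rate, since `1 / ε ≥ 1`.
  obtain ⟨r, hr⟩ : ∃ r : ℕ, α ≤ 2 ^ r := (pow_unbounded_of_one_lt α one_lt_two).imp fun _ h => h.le
  obtain ⟨l, C, hC1, hl, happrox⟩ := exists_local_log_approx r
  obtain ⟨P, hP⟩ : ∃ P : ℕ, P = 2 ^ r + 1 := ⟨_, rfl⟩
  have hPR : (1 : ℝ) ≤ P := by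
    rw [hP]; push_cast; linarith [pow_nonneg (zero_le_two (α := ℝ)) r]
  have hlog2 := Real.log_two_gt_d9
  refine ⟨20 + r * (C + 4), 9 * C * P + 12 * C,
    2 * (12 + 3 * C * (4 + P * 3) + 3 * C * P + 2 + 36 * C) + 3 * C * P * r * (16 + 12 * C),
    by positivity, by positivity, by positivity, ?_⟩
  rintro a b ε ⟨ha0, ha1⟩ ⟨hab, hb1⟩ hε
  obtain ⟨N, n, c, q, hN0, hNle, hnle, hq0, hq1, hqN, hcC, hc0, hcq, hcerr⟩ := happrox ε hε
  obtain ⟨hε0, hε1⟩ := hε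
  have hinv : 2 ≤ 1 / ε := by rw [le_div_iff₀ hε0]; linarith
  have hLε : 1 / 2 ≤ Real.log (1 / ε) :=
    le_trans (by linarith) (Real.log_le_log (by norm_num) hinv)
  have hLa : Real.log 2 ≤ Real.log (1 / a) :=
    Real.log_le_log (by norm_num) (by rw [le_div_iff₀ ha0]; linarith)
  have hLa0 : 0 < Real.log (1 / a) := by linarith
  have hlogb : Real.log b ≤ 0 := Real.log_nonpos (by linarith) hb1
  have hlogab : Real.log a ≤ Real.log b := Real.log_le_log ha0 hab.le
  have hloga : Real.log (1 / a) = -Real.log a := by rw [one_div, Real.log_inv]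
  -- The number of dyadic scales.
  obtain ⟨K, hK⟩ : ∃ K : ℕ, K = ⌈Real.log (1 / a) / Real.log 2⌉₊ := ⟨_, rfl⟩
  have hK0 : 0 < K := by rw [hK]; exact Nat.ceil_pos.mpr (by positivity)
  have hKlo : Real.log (1 / a) ≤ K * Real.log 2 := by
    rw [← div_le_iff₀ (by positivity), hK]; exact Nat.le_ceil _
  have hKhi : (K : ℝ) ≤ 3 * Real.log (1 / a) := by
    have h1 : (K : ℝ) < Real.log (1 / a) / Real.log 2 + 1 := by
      rw [hK]; exact Nat.ceil_lt_add_one (by positivity)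
    have h2 : Real.log (1 / a) / Real.log 2 ≤ 3 / 2 * Real.log (1 / a) := by
      rw [div_le_iff₀ (by positivity), mul_right_comm]
      exact le_mul_of_one_le_left (by linarith) (by linarith)
    linarith
  -- The number of copies in the output stage bounds the coefficients and `log (1 / a)`.
  obtain ⟨R, hR⟩ : ∃ R : ℕ, R = ⌈2 * C * Real.log (1 / a)⌉₊ := ⟨_, rfl⟩
  have hR0 : 0 < R := by rw [hR]; exact Nat.ceil_pos.mpr (by positivity)
  have hRlo : 2 * C * Real.log (1 / a) ≤ R := by rw [hR]; exact Nat.le_ceil _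
  have hCLa : Real.log (1 / a) ≤ C * Real.log (1 / a) :=
    le_mul_of_one_le_left (by linarith) hC1
  have hRhi : (R : ℝ) ≤ 3 * C * Real.log (1 / a) + 1 / 2 := by
    have h1 : (R : ℝ) < 2 * C * Real.log (1 / a) + 1 := by
      rw [hR]; exact Nat.ceil_lt_add_one (by positivity)
    linarith
  have hCR : C ≤ R := by
    refine le_trans ?_ hRlo
    have : C * (1 / 2) ≤ C * Real.log (1 / a) := by gcongr; linarith
    linarith
  have hLR : Real.log (1 / a) ≤ R := by linarith
  have : NeZero K := ⟨hK0.ne'⟩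
  have : NeZero N := ⟨hN0.ne'⟩
  have : NeZero R := ⟨hR0.ne'⟩
  have : Nonempty (Fin (K * N)) := ⟨⟨0, by positivity⟩⟩
  -- The approximation on one piece and the resulting function.
  let g : ℝ → ℝ := fun y => ∑ i, c i * (sqApprox n)^[r] (1 - l i * (1 - y))
  have hg1 : g 1 = 0 := by
    simp only [g, sub_self, mul_zero, sub_zero, sqApprox_iterate_one, mul_one, hc0]
  let Y : ℝ → ℝ := fun x => ∑ k : Fin (K * N) × Fin (2 ^ r + 1),
    -c k.2 * (sqApprox n)^[r] (1 - l k.2 * (1 - max q (min (relu x / q ^ k.1.val) 1)))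
  have hY : ∀ z ∈ Set.Icc a b, |-Y z - Real.log z| ≤ ε := by
    rintro z ⟨hz0, hz1⟩
    have h := abs_sum_clip_sub_log_le (g := g) hq0 hq1.le hε0.le hg1 hcq hcerr (K * N) z
      ⟨?_, hz1.trans hb1⟩
    · convert h using 3
      simp only [Y, g]
      rw [Fintype.sum_prod_type, Finset.sum_range, ← Finset.sum_neg_distrib,
        relu_of_nonneg (ha0.le.trans hz0)]
      refine Finset.sum_congr rfl fun j _ => ?_
      rw [← Finset.sum_neg_distrib]
      exact Finset.sum_congr rfl fun i _ => by ring
    · rw [mul_comm, pow_mul, hqN]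
      refine le_trans ?_ hz0
      rw [← Real.log_le_log_iff (by positivity) ha0, Real.log_pow, one_div, Real.log_inv]
      linarith
  -- The network.
  obtain ⟨w, hw⟩ : ∃ w : ℕ, w = K * N * (P * 3) + R * 3 := ⟨_, rfl⟩
  have hXmem : ∀ (k : Fin (K * N) × Fin (2 ^ r + 1)) (x : ℝ),
      1 - l k.2 * (1 - max q (min (relu x / q ^ k.1.val) 1)) ∈ Set.Icc (0 : ℝ) 1 := by
    intro k x
    obtain ⟨hl0, hl1⟩ := hl k.2
    have h1 := le_max_left q (min (relu x / q ^ k.1.val) 1)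
    have h2 : max q (min (relu x / q ^ k.1.val) 1) ≤ 1 := max_le hq1.le (min_le_right _ _)
    set y := max q (min (relu x / q ^ k.1.val) 1)
    have h3 : 0 ≤ l k.2 * (1 - y) := mul_nonneg hl0 (by linarith)
    have h4 : l k.2 * (1 - y) ≤ 1 / 2 * 1 := by gcongr; linarith
    constructor <;> linarith
  have hnet := ((Computes.affine_clip (w := w) (K := K) (N := N) hl hq0 hq1 hqN (by
    rw [Fintype.card_fin, ← hP, hw]
    exact (Nat.mul_le_mul_left _ (by omega)).trans (Nat.le_add_right _ _))).sq_iterate hXmem (by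
      rw [Fintype.card_prod, Fintype.card_fin, Fintype.card_fin, ← hP, hw, mul_assoc]
      exact Nat.le_add_right _ _) n r)
  have hpow : (1 / ε) ^ (1 / (2 ^ r : ℝ)) ≤ (1 / ε) ^ (1 / α) :=
    Real.rpow_le_rpow_of_exponent_le (by linarith) (one_div_le_one_div_of_le hα hr)
  have hE1 : 1 ≤ (1 / ε) ^ (1 / α) := Real.one_le_rpow (by linarith) (by positivity)
  have hNle' : (N : ℝ) ≤ C * (1 / ε) ^ (1 / α) := hNle.trans (by gcongr)
  generalize (1 / ε) ^ (1 / α) = E at hNle' hE1 ⊢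
  obtain ⟨La, hLadef⟩ : ∃ La, La = Real.log (1 / a) := ⟨_, rfl⟩
  obtain ⟨Lε, hLεdef⟩ : ∃ Lε, Lε = Real.log (1 / ε) := ⟨_, rfl⟩
  simp only [← hLadef] at *
  simp only [← hLεdef] at *
  have hLε0 : 0 < Lε := by linarith
  have hKN : (K : ℝ) * N ≤ 3 * C * (E * La) := by
    calc (K : ℝ) * N ≤ 3 * La * (C * E) := by gcongr
      _ = 3 * C * (E * La) := by ring
  have hELa : La ≤ E * La := le_mul_of_one_le_left hLa0.le hE1
  have hRE : (R : ℝ) ≤ 4 * C * (E * La) := by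
    have h1 : C * La ≤ C * (E * La) := by gcongr
    linarith
  refine ⟨fun x => -max (-Real.log b) (min (Y x) (-Real.log a)), ?_, ?_, fun t => ⟨?_, ?_⟩⟩
  · refine hnet.clamp (R := R) (fun k => -c k.2)
      (fun k => by rw [abs_neg]; exact (hcC _).trans hCR) (neg_nonneg.mpr hlogb)
      (neg_le_neg hlogab) (by rwa [← hloga]) (by rw [hw]; exact Nat.le_add_left _ _) ?_ ?_ ?_
    · have h1 : (r : ℝ) * (n + 2) ≤ r * ((C + 4) * Lε) := by
        gcongr
        linarith
      push_cast
      linarith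
    · rw [hw]
      push_cast
      have h1 : (K : ℝ) * N * (P * 3) ≤ 3 * C * (E * La) * (P * 3) := by gcongr
      linarith
    · rw [Fintype.card_prod, Fintype.card_fin, Fintype.card_fin, ← hP,
        ← ENNReal.ofReal_natCast]
      refine ENNReal.ofReal_le_ofReal ?_
      push_cast
      have h1 : (K : ℝ) * (K * 6) ≤ 3 * La * (3 * La * 6) := by gcongr
      have h2 : (K : ℝ) * N * P ≤ 3 * C * (E * La) * P := by gcongr
      have h3 : (8 + n * 12 : ℝ) ≤ (16 + 12 * C) * Lε := by linarith
      have h4 : (r : ℝ) * (K * N * P * (8 + n * 12))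
          ≤ r * (3 * C * (E * La) * P * ((16 + 12 * C) * Lε)) := by gcongr
      have h5 : E * La ≤ 2 * (E * Lε * La) := by
        have : E * La * (1 / 2) ≤ E * La * Lε := by gcongr
        linarith
      have h6 : (12 + 3 * C * (4 + P * 3) + 3 * C * P + 2 + 36 * C) * (E * La)
          ≤ (12 + 3 * C * (4 + P * 3) + 3 * C * P + 2 + 36 * C) * (2 * (E * Lε * La)) := by
        gcongr
      have h7 : 0 ≤ La ^ 2 := sq_nonneg _
      linarith
  · rintro z hz
    have h1 : Real.log a ≤ Real.log z := Real.log_le_log ha0 hz.1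
    have h2 : Real.log z ≤ Real.log b := Real.log_le_log (ha0.trans_le hz.1) hz.2
    have h := hY z hz
    rw [abs_le] at h ⊢
    rcases max_cases (-Real.log b) (min (Y z) (-Real.log a)) with h3 | h3 <;>
    rcases min_cases (Y z) (-Real.log a) with h4 | h4 <;>
    constructor <;> linarith [h.1, h.2]
  · have : max (-Real.log b) (min (Y t) (-Real.log a)) ≤ -Real.log a :=
      max_le (neg_le_neg hlogab) (min_le_right _ _)
    linarith
  · have := le_max_left (-Real.log b) (min (Y t) (-Real.log a))
    linarith
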